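/- Consider the triangular lattice, drawn with horizontal lattice lines, with the following coordinates: one unit on the horizontal $i$-axis is half the side of a unit triangle, one unit on the vertical $j$-axis is the height of a unit triangle, and the lattice vertices are the integer points $(i,j)$ with $i+j$ odd. Let $x,n\ge 0$ be integers and let $1\le s_1<s_2<\dots<s_n\le n+x$ be integers. The quartered hexagon $R^2_x(s_1,\dots,s_n)$ is obtained from the right trapezoidal region with side-lengths $x,\,2n,\,x+n,\,2n$ (north, west, south, northeast) by removing $n$ up-pointing unit triangles along its base. Precisely, the trapezoidal region is bounded by the south side from $(1,0)$ to $(2(x+n)+1,0)$, the northeast side from there to $(2x+1,2n)$, the north side from $(2x+1,2n)$ to $(1,2n)$, and, on the west, the vertical zigzag through $(1,0),(0,1),(1,2),(0,3),\dots,(0,2n-1),(1,2n)$, which touches the $j$-axis; the removed triangles are those whose base edges join $(2s_i-1,0)$ to $(2s_i+1,0)$, $i=1,\dots,n$, i.e. the up-pointing unit triangles at positions $s_1,\dots,s_n$, from left to right, along the base. A lozenge is the union of two unit triangles sharing an edge; it is vertical if the shared edge is horizontal. Each vertical lozenge with center $(i,j)$ has weight $\operatorname{wt}_1(i,j)=\frac{q^{i}+q^{-i}}{2}$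 and every other lozenge has weight $1$, where $q$ is an indeterminate. The weight of a lozenge tiling is the product of the weights of its lozenges, and $\operatorname{M}(R^2_x(s_1,\dots,s_n))$ is the sum of the weights of all lozenge tilings of the region (the empty region, $n=0$, has exactly one tiling, of weight $1$). Write $[m]_q=1+q+\dots+q^{m-1}$ and $[m]_q!=[1]_q[2]_q\cdots[m]_q$. Then \begin{align*} \operatorname{M}(R^{2}_{x}(s_1,\dots,s_n)) &=2^{-n^2}q^{-\sum_{i=1}^n((4i-2)s_i-2i^2+i)}\,\frac{\prod_{i=1}^{n}[2s_i]_{q^2}\prod_{1\leq i<j\leq n}[2(s_i+s_j)]_{q^2}[2(s_j-s_i)]_{q^2}}{\prod_{i=1}^{n}[2i-1]_{q^2}!}\\ &=2^{-n^2}q^{-\sum_{i=1}^n((4i-2)s_i-2i^2+i)}\prod_{i=1}^{n}\frac{1}{q^{4s_i}+1}\prod_{1\leq i\leq j\leq n}\frac{[2(s_i+s_j)]_{q^2}}{[i+j-1]_{q^2}}\prod_{1\leq i<j\leq n}\frac{[2(s_j-s_i)]_{q^2}}{[j-i]_{q^2}}. \end{align*} -/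

import Mathlib

namespace QuarteredHexagon

/-!
Coordinates.  One unit on the horizontal `i`-axis is half the side of a unit triangle, one unit on
the vertical `j`-axis is the height of a unit triangle.  The lattice vertices are the integer
points `(i, j)` with `i + j` odd.  A unit triangle is recorded as `(c, r) : ℤ × ℤ`, where `c` is
the abscissa of its axis of symmetry and `r`, `r + 1` are the ordinates of the two horizontal lines
bounding it.  It is up-pointing if `c + r` is even and down-pointing if `c + r` is odd, and every
pair of integers is exactly one unit triangle.
-/

/-- The unit triangle `t` points up. -/
def IsUp (t : ℤ × ℤ) : Prop := Even (t.1 + t.2)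

instance : DecidablePred IsUp := fun t => inferInstanceAs (Decidable (Even (t.1 + t.2)))

/-- The three corners of a unit triangle. -/
def vertices (t : ℤ × ℤ) : Finset (ℤ × ℤ) :=
  if IsUp t then {(t.1 - 1, t.2), (t.1 + 1, t.2), (t.1, t.2 + 1)}
  else {(t.1 - 1, t.2 + 1), (t.1 + 1, t.2 + 1), (t.1, t.2)}

/-- A lozenge is the union of two unit triangles sharing an edge.  Such triangles have opposite
orientations; the lozenge is recorded as the pair (down-pointing half, up-pointing half). -/
def IsLozenge (l : (ℤ × ℤ) × (ℤ × ℤ)) : Prop :=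
  ¬ IsUp l.1 ∧ IsUp l.2 ∧ (vertices l.1 ∩ vertices l.2).card = 2

/-- A lozenge is vertical if its two halves share a horizontal edge, i.e. its up-pointing half
lies directly above its down-pointing half.  Its center has abscissa `l.1.1`. -/
def IsVertical (l : (ℤ × ℤ) × (ℤ × ℤ)) : Prop := l.2 = (l.1.1, l.1.2 + 1)

instance : DecidablePred IsVertical :=
  fun l => inferInstanceAs (Decidable (l.2 = (l.1.1, l.1.2 + 1)))

/-- `T` is a lozenge tiling of the region `R` (a finite set of unit triangles): all lozenges of `T`
lie in `R`, and every unit triangle of `R` belongs to exactly one of them. -/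
def IsTiling (R : Finset (ℤ × ℤ)) (T : Finset ((ℤ × ℤ) × (ℤ × ℤ))) : Prop :=
  (∀ l ∈ T, IsLozenge l ∧ l.1 ∈ R ∧ l.2 ∈ R) ∧
    ∀ t ∈ R, ∃! l : (ℤ × ℤ) × (ℤ × ℤ), l ∈ T ∧ (t = l.1 ∨ t = l.2)

open Classical in
/-- The finite set of all lozenge tilings of `R`. -/
noncomputable def tilings (R : Finset (ℤ × ℤ)) : Finset (Finset ((ℤ × ℤ) × (ℤ × ℤ))) :=
  (R ×ˢ R).powerset.filter (IsTiling R)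

/-- The symmetric weight: `(q ^ i + q ^ (-i)) / 2` for a vertical lozenge whose center has abscissa
`i`, and `1` for every other lozenge. -/
noncomputable def symWeight {K : Type*} [Field K] (q : K) (l : (ℤ × ℤ) × (ℤ × ℤ)) : K :=
  if IsVertical l then (q ^ l.1.1 + q ^ (-l.1.1)) / 2 else 1

/-- The tiling generating function of the region `R` under the symmetric weight. -/
noncomputable def tilingGF {K : Type*} [Field K] (q : K) (R : Finset (ℤ × ℤ)) : K :=
  ∑ T ∈ tilings R, ∏ l ∈ T, symWeight q l

/-- The right trapezoidal region with side lengths `x, 2n, x + n, 2n` (north, west, south,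
northeast): all unit triangles whose corners satisfy `0 ≤ i`, `0 ≤ j ≤ 2n` and
`i + j ≤ 2(x + n) + 1`.  The base goes from `(1, 0)` to `(2(x + n) + 1, 0)`, the north side from
`(1, 2n)` to `(2x + 1, 2n)`, and the west side is the zigzag
`(1, 0), (0, 1), (1, 2), (0, 3), …, (1, 2n)`, which touches the `j`-axis from the right. The product
of intervals is only a bounding box. -/
noncomputable def trapezoid (x n : ℕ) : Finset (ℤ × ℤ) :=
  (Finset.Icc (0 : ℤ) (2 * (x + n) + 1) ×ˢ Finset.Icc (0 : ℤ) (2 * n)).filter fun t =>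
    ∀ v ∈ vertices t, 0 ≤ v.1 ∧ 0 ≤ v.2 ∧ v.2 ≤ 2 * n ∧ v.1 + v.2 ≤ 2 * (x + n) + 1

/-- The shape of the quartered hexagon `R²_x(s_1, …, s_n)`: the up-pointing triangles at the
positions `s_1, …, s_n` along the base are removed.  The `p`-th up-pointing triangle on the base
(`p = 1, …, x + n`) has the base edge from `(2p - 1, 0)` to `(2p + 1, 0)`. -/
noncomputable def quarteredHexagon (x n : ℕ) (s : Fin n → ℕ) : Finset (ℤ × ℤ) :=
  trapezoid x n \ Finset.univ.image fun i => (2 * (s i : ℤ), (0 : ℤ))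

/-- The `q`-integer `[m]_q = 1 + q + ⋯ + q ^ (m - 1)`. -/
def qInt {K : Type*} [Field K] (q : K) (m : ℕ) : K := ∑ k ∈ Finset.range m, q ^ k

/-- The `q`-factorial `[m]_q! = [1]_q [2]_q ⋯ [m]_q`. -/
def qFactorial {K : Type*} [Field K] (q : K) (m : ℕ) : K :=
  ∏ k ∈ Finset.range m, qInt q (k + 1)

/-- The exponent `∑_{i=1}^n ((4i - 2) s_i - 2i² + i)`; the index `i` of the sum is `(i : Fin n) + 1`. -/
def qExponent (n : ℕ) (s : Fin n → ℕ) : ℤ :=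
  ∑ i : Fin n, ((4 * ((i : ℤ) + 1) - 2) * (s i : ℤ) - 2 * ((i : ℤ) + 1) ^ 2 + ((i : ℤ) + 1))

end QuarteredHexagon

/-! ### Lozenge tilings and removal of a lozenge. -/

namespace QuarteredHexagon

/-! A tiling is read row by row from the base. In a row whose removed up-pointing triangles are
known, everything is forced except the columns of the vertical lozenges rising into the next row,
and these interlace with the removed columns. In an even row the west boundary acts as one more
removed triangle at column `0`, so `m` removed triangles give `m` vertical lozenges; in an odd row
they give `m - 1`. Two rows thus lower `m` by one.

With `q = e^t`, `colWeight q c` is `cosh(ct)` and `qDiff q k` is `2 sinh(kt)`. By induction on `m`,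
an even row with removed columns `c` has generating function constant × `∏ qDiff q (c i)` ×
`colVandermonde q c`, and an odd row has constant × `colVandermonde q c` (`tilingGF_rowRegion_eq`).
The weights turn each summand into a determinant of `sinh` of even multiples or `cosh` of odd
multiples of the columns. Each entry has a discrete antiderivative of step 2, so the sum over
interlacing columns telescopes into one bordered determinant (`sum_det_colsBetween`), which
three-term recursions evaluate as a Vandermonde determinant (`Matrix.det_of_threeTermRecursion`).
These are `sum_interlacing_odd` and `sum_interlacing_even`. It remains to rewrite the constants and
Vandermonde factors in `q²`-integers (`product_formula`). -/

theorem isLozenge_iff {d u : ℤ × ℤ} :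
    IsLozenge (d, u) ↔
      ¬ IsUp d ∧ (u = (d.1 - 1, d.2) ∨ u = (d.1 + 1, d.2) ∨ u = (d.1, d.2 + 1)) := by
  obtain ⟨a, b⟩ := d
  obtain ⟨c, e⟩ := u
  unfold IsLozenge
  constructor
  · rintro ⟨hd, hu, hcard⟩
    refine ⟨hd, ?_⟩
    obtain ⟨v, w, hvw, h⟩ := Finset.card_eq_two.mp hcard
    have hv : v ∈ vertices (a, b) ∩ vertices (c, e) := by rw [h]; simp
    have hw : w ∈ vertices (a, b) ∩ vertices (c, e) := by rw [h]; simp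
    obtain ⟨v1, v2⟩ := v
    obtain ⟨w1, w2⟩ := w
    simp only [vertices, hd, hu, if_false, if_true, Finset.mem_inter, Finset.mem_insert,
      Finset.mem_singleton, Prod.mk.injEq, ne_eq] at hv hw hvw ⊢
    clear h hcard hd hu
    omega
  · rintro ⟨hd, h⟩
    have hu : IsUp (c, e) := by
      simp only [IsUp, Prod.mk.injEq, Int.even_iff] at hd h ⊢
      omega
    refine ⟨hd, hu, ?_⟩
    rw [Finset.card_eq_two]
    simp only [vertices, hd, hu, if_false, if_true]
    simp only [Prod.mk.injEq] at h
    rcases h with ⟨rfl, rfl⟩ | ⟨rfl, rfl⟩ | ⟨rfl, rfl⟩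
    · refine ⟨(a - 1, e + 1), (a, e), by simp, ?_⟩
      ext ⟨y, z⟩
      simp only [Finset.mem_inter, Finset.mem_insert, Finset.mem_singleton, Prod.mk.injEq]
      omega
    · refine ⟨(a + 1, e + 1), (a, e), by simp, ?_⟩
      ext ⟨y, z⟩
      simp only [Finset.mem_inter, Finset.mem_insert, Finset.mem_singleton, Prod.mk.injEq]
      omega
    · refine ⟨(c - 1, b + 1), (c + 1, b + 1), by simp; omega, ?_⟩
      ext ⟨y, z⟩
      simp only [Finset.mem_inter, Finset.mem_insert, Finset.mem_singleton, Prod.mk.injEq]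
      omega

theorem mem_tilings {R : Finset (ℤ × ℤ)} {T : Finset ((ℤ × ℤ) × (ℤ × ℤ))} :
    T ∈ tilings R ↔ IsTiling R T := by
  simp only [tilings, Finset.mem_filter, Finset.mem_powerset, and_iff_right_iff_imp]
  intro h l hl
  exact Finset.mem_product.mpr (h.1 l hl).2

theorem IsTiling.erase {R : Finset (ℤ × ℤ)} {T : Finset ((ℤ × ℤ) × (ℤ × ℤ))}
    {l : (ℤ × ℤ) × (ℤ × ℤ)} (hT : IsTiling R T) (hl : l ∈ T) :
    IsTiling (R \ {l.1, l.2}) (T.erase l) := by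
  have hlR := (hT.1 l hl).2
  constructor
  · intro m hm
    obtain ⟨hne, hmT⟩ := Finset.mem_erase.mp hm
    obtain ⟨h1, h2, h3⟩ := hT.1 m hmT
    have key : ∀ t ∈ R, (t = m.1 ∨ t = m.2) → ¬ (t = l.1 ∨ t = l.2) := fun t ht h h' =>
      hne ((hT.2 t ht).unique ⟨hmT, h⟩ ⟨hl, h'⟩)
    refine ⟨h1, ?_, ?_⟩
    · simpa [h2] using key m.1 h2 (Or.inl rfl)
    · simpa [h3] using key m.2 h3 (Or.inr rfl)
  · intro t ht
    simp only [Finset.mem_sdiff, Finset.mem_insert, Finset.mem_singleton] at ht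
    obtain ⟨m, ⟨hmT, hm⟩, huniq⟩ := hT.2 t ht.1
    refine ⟨m, ⟨Finset.mem_erase.mpr ⟨?_, hmT⟩, hm⟩, fun m' hm' =>
      huniq m' ⟨Finset.mem_of_mem_erase hm'.1, hm'.2⟩⟩
    rintro rfl
    exact ht.2 hm

theorem IsTiling.notMem_of_sdiff {R : Finset (ℤ × ℤ)} {T : Finset ((ℤ × ℤ) × (ℤ × ℤ))}
    {l : (ℤ × ℤ) × (ℤ × ℤ)} (hT : IsTiling (R \ {l.1, l.2}) T) : l ∉ T := fun h => by
  simpa using (hT.1 l h).2.1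

theorem IsTiling.insert {R : Finset (ℤ × ℤ)} {T : Finset ((ℤ × ℤ) × (ℤ × ℤ))}
    {l : (ℤ × ℤ) × (ℤ × ℤ)} (hT : IsTiling (R \ {l.1, l.2}) T) (hl : IsLozenge l)
    (h1 : l.1 ∈ R) (h2 : l.2 ∈ R) : IsTiling R (insert l T) := by
  constructor
  · intro m hm
    rcases Finset.mem_insert.mp hm with rfl | hm
    · exact ⟨hl, h1, h2⟩
    · obtain ⟨a, b, c⟩ := hT.1 m hm
      exact ⟨a, Finset.sdiff_subset b, Finset.sdiff_subset c⟩
  · intro t ht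
    by_cases h : t = l.1 ∨ t = l.2
    · refine ⟨l, ⟨Finset.mem_insert_self _ _, h⟩, fun m ⟨hm, hmt⟩ => ?_⟩
      rcases Finset.mem_insert.mp hm with rfl | hm
      · rfl
      · exfalso
        obtain ⟨-, b, c⟩ := hT.1 m hm
        simp only [Finset.mem_sdiff, Finset.mem_insert, Finset.mem_singleton] at b c
        rcases hmt with rfl | rfl
        exacts [b.2 h, c.2 h]
    · obtain ⟨m, ⟨hmT, hm⟩, huniq⟩ := hT.2 t (by simpa [ht] using h)
      refine ⟨m, ⟨Finset.mem_insert_of_mem hmT, hm⟩, fun m' ⟨hm', hmt⟩ => ?_⟩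
      rcases Finset.mem_insert.mp hm' with rfl | hm'
      · exact absurd hmt h
      · exact huniq m' ⟨hm', hmt⟩

/-- Expansion of the tiling generating function over the lozenges through a fixed unit triangle. -/
theorem tilingGF_expand {K : Type*} [Field K] (q : K) {R : Finset (ℤ × ℤ)} {t : ℤ × ℤ}
    (ht : t ∈ R) (S : Finset ((ℤ × ℤ) × (ℤ × ℤ)))
    (hS : ∀ l, l ∈ S ↔ IsLozenge l ∧ l.1 ∈ R ∧ l.2 ∈ R ∧ (t = l.1 ∨ t = l.2)) :
    tilingGF q R = ∑ l ∈ S, symWeight q l * tilingGF q (R \ {l.1, l.2}) := by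
  simp only [tilingGF, Finset.mul_sum]
  rw [Finset.sum_sigma']
  symm
  have hT : ∀ a ∈ S.sigma fun l => tilings (R \ {l.1, l.2}),
      IsTiling (R \ {a.1.1, a.1.2}) a.2 ∧ IsTiling R (insert a.1 a.2) ∧
        (t = a.1.1 ∨ t = a.1.2) := by
    rintro ⟨l, T⟩ h
    simp only [Finset.mem_sigma, mem_tilings] at h
    obtain ⟨h1, h2, h3, h4⟩ := (hS l).mp h.1
    exact ⟨h.2, h.2.insert h1 h2 h3, h4⟩
  refine Finset.sum_bij (fun a _ => insert a.1 a.2) ?_ ?_ ?_ ?_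
  · intro a ha
    exact mem_tilings.mpr (hT a ha).2.1
  · rintro ⟨l, T⟩ ha ⟨l', T'⟩ ha' heq
    obtain ⟨h1, h2, h3⟩ := hT _ ha
    obtain ⟨h1', h2', h3'⟩ := hT _ ha'
    simp only at heq h1 h2 h3 h1' h2' h3'
    have hl : l = l' := (h2.2 t ht).unique ⟨Finset.mem_insert_self _ _, h3⟩
      ⟨by rw [heq]; exact Finset.mem_insert_self _ _, h3'⟩
    subst hl
    rw [← Finset.erase_insert h1.notMem_of_sdiff, heq, Finset.erase_insert h1'.notMem_of_sdiff]
  · intro T hT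
    rw [mem_tilings] at hT
    obtain ⟨l, ⟨hlT, hl⟩, -⟩ := hT.2 t ht
    refine ⟨⟨l, T.erase l⟩, ?_, Finset.insert_erase hlT⟩
    obtain ⟨h1, h2, h3⟩ := hT.1 l hlT
    exact Finset.mem_sigma.mpr ⟨(hS l).mpr ⟨h1, h2, h3, hl⟩, mem_tilings.mpr (hT.erase hlT)⟩
  · intro a ha
    rw [Finset.prod_insert (hT a ha).1.notMem_of_sdiff]

theorem tilingGF_empty {K : Type*} [Field K] (q : K) : tilingGF q ∅ = 1 := by
  have h : tilings ∅ = {∅} := by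
    ext T
    simp only [mem_tilings, Finset.mem_singleton]
    constructor
    · intro h
      refine Finset.eq_empty_of_forall_notMem fun l hl => ?_
      simpa using (h.1 l hl).2.1
    · rintro rfl
      exact ⟨by simp, by simp⟩
  simp [tilingGF, h]

end QuarteredHexagon

/-! ### Peeling one row from left to right. -/

namespace QuarteredHexagon

theorem mem_trapezoid {x n : ℕ} {c r : ℤ} :
    (c, r) ∈ trapezoid x n ↔ 1 ≤ c ∧ 0 ≤ r ∧ r < 2 * n ∧ c + r ≤ 2 * (x + n) := by
  simp only [trapezoid, Finset.mem_filter, Finset.mem_product, Finset.mem_Icc]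
  by_cases h : IsUp (c, r)
  · simp only [vertices, h, if_true, Finset.mem_insert, Finset.mem_singleton, forall_eq_or_imp,
      forall_eq]
    omega
  · simp only [vertices, h, if_false, Finset.mem_insert, Finset.mem_singleton, forall_eq_or_imp,
      forall_eq]
    -- The corners of a down-pointing triangle give `c + r ≤ 2(x + n) - 1`; since `c + r` is odd,
    -- this is the same as `c + r ≤ 2(x + n)`.
    rw [IsUp, Int.even_iff] at h
    simp only at h
    omega

/-- The weight of a vertical lozenge whose center has abscissa `c`. -/
noncomputable def colWeight {K : Type*} [Field K] (q : K) (c : ℤ) : K := (q ^ c + q ^ (-c)) / 2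

theorem symWeight_vertical {K : Type*} [Field K] (q : K) (c r : ℤ) :
    symWeight q ((c, r), (c, r + 1)) = colWeight q c := by
  simp [symWeight, IsVertical, colWeight]

theorem symWeight_row {K : Type*} [Field K] (q : K) (c c' r : ℤ) :
    symWeight q ((c, r), (c', r)) = 1 := by
  simp [symWeight, IsVertical]

/-- The part of the trapezoid that consists of the columns `> c` of row `r`, without the columns in
`A`, and of all rows above row `r`, without the columns in `V` of row `r + 1`. -/
noncomputable def rowRegion (x n : ℕ) (r : ℤ) (A : Finset ℤ) (c : ℤ) (V : Finset ℤ) :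
    Finset (ℤ × ℤ) :=
  (trapezoid x n).filter fun t =>
    (t.2 = r ∧ c < t.1 ∧ t.1 ∉ A) ∨ (r < t.2 ∧ ¬ (t.2 = r + 1 ∧ t.1 ∈ V))

theorem mem_rowRegion {x n : ℕ} {r c : ℤ} {A V : Finset ℤ} {a b : ℤ} :
    (a, b) ∈ rowRegion x n r A c V ↔
      (1 ≤ a ∧ 0 ≤ b ∧ b < 2 * n ∧ a + b ≤ 2 * (x + n)) ∧
        ((b = r ∧ c < a ∧ a ∉ A) ∨ (r < b ∧ ¬ (b = r + 1 ∧ a ∈ V))) := by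
  simp only [rowRegion, Finset.mem_filter, mem_trapezoid]

section Peeling

variable {K : Type*} [Field K] (q : K) {x n : ℕ} {r c : ℤ} {A V : Finset ℤ}

theorem rowRegion_of_mem (h : c + 1 ∈ A) :
    rowRegion x n r A c V = rowRegion x n r A (c + 1) V := by
  ext ⟨a, b⟩
  simp only [mem_rowRegion]
  have : a = c + 1 → a ∈ A := fun h' => h' ▸ h
  by_cases hA : a ∈ A
  · simp [hA]
  · have : a ≠ c + 1 := fun h' => hA (this h')
    simp only [hA, not_false_iff, and_true]
    have : c < a ↔ c + 1 < a := by omega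
    rw [this]

theorem rowRegion_sdiff_row (hr : 0 ≤ r) {t u : ℤ × ℤ}
    (h : (t = (c + 1, r) ∧ u = (c + 2, r)) ∨ (t = (c + 2, r) ∧ u = (c + 1, r))) :
    rowRegion x n r A c V \ {t, u} = rowRegion x n r A (c + 2) V := by
  ext ⟨a, b⟩
  simp only [Finset.mem_sdiff, mem_rowRegion, Finset.mem_insert, Finset.mem_singleton]
  rcases h with ⟨rfl, rfl⟩ | ⟨rfl, rfl⟩ <;> simp only [Prod.mk.injEq] <;>
  by_cases hA : a ∈ A <;> by_cases hV : a ∈ V <;>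
    simp only [hA, hV, not_true_eq_false, not_false_eq_true, and_true, and_false,
      false_or] <;> omega

theorem rowRegion_sdiff_vertical :
    rowRegion x n r A c V \ {(c + 1, r), (c + 1, r + 1)} =
      rowRegion x n r A (c + 1) (insert (c + 1) V) := by
  ext ⟨a, b⟩
  simp only [Finset.mem_sdiff, mem_rowRegion, Finset.mem_insert, Finset.mem_singleton,
    Prod.mk.injEq]
  by_cases hA : a ∈ A <;> by_cases hV : a ∈ V <;>
    simp only [hA, hV, not_true_eq_false, not_false_eq_true, and_true, and_false, or_true, or_false,
      false_or] <;> omega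

/-- The left and lower neighbours of the up-pointing triangle at `c + 1` are gone, so it must pair
to the right. -/
theorem tilingGF_rowRegion_up (hr : 0 ≤ r) (hrn : r < 2 * n) (hc : 0 ≤ c)
    (hpar : (c + 1 + r) % 2 = 0) (h1 : c + 1 ∉ A) (h2 : c + 2 ∉ A)
    (hle : c + 2 + r ≤ 2 * (x + n)) :
    tilingGF q (rowRegion x n r A c V) = tilingGF q (rowRegion x n r A (c + 2) V) := by
  have ht : (c + 1, r) ∈ rowRegion x n r A c V := by
    rw [mem_rowRegion]
    exact ⟨by omega, Or.inl ⟨rfl, by omega, h1⟩⟩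
  rw [tilingGF_expand q ht {((c + 2, r), (c + 1, r))}]
  · rw [Finset.sum_singleton, symWeight_row, one_mul]
    dsimp only
    rw [rowRegion_sdiff_row hr (Or.inr ⟨rfl, rfl⟩)]
  · rintro ⟨⟨a, b⟩, ⟨a', b'⟩⟩
    simp only [isLozenge_iff, Finset.mem_singleton, Prod.mk.injEq, mem_rowRegion, IsUp,
      Int.even_iff]
    constructor
    · rintro ⟨⟨rfl, rfl⟩, rfl, rfl⟩
      simp only [h1, h2, not_false_eq_true, and_true, true_and, or_true]
      omega
    · rintro ⟨h3, h4, h5, h6⟩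
      omega

theorem tilingGF_rowRegion_up_last (hr : 0 ≤ r) (hrn : r < 2 * n) (hc : 0 ≤ c)
    (hpar : (c + 1 + r) % 2 = 0) (h1 : c + 1 ∉ A) (hle : c + 1 + r = 2 * (x + n)) :
    tilingGF q (rowRegion x n r A c V) = 0 := by
  have ht : (c + 1, r) ∈ rowRegion x n r A c V := by
    rw [mem_rowRegion]
    exact ⟨by omega, Or.inl ⟨rfl, by omega, h1⟩⟩
  rw [tilingGF_expand q ht ∅, Finset.sum_empty]
  rintro ⟨⟨a, b⟩, ⟨a', b'⟩⟩
  simp only [isLozenge_iff, Finset.notMem_empty, Prod.mk.injEq, mem_rowRegion, IsUp,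
    Int.even_iff, false_iff]
  rintro ⟨h3, h4, h5, h6⟩
  omega

/-- A leftmost down-pointing triangle pairs either to the right, unless that neighbour is removed,
or upwards, unless the row is the top one. -/
theorem tilingGF_rowRegion_down (hr : 0 ≤ r) (hrn : r < 2 * n) (hc : 0 ≤ c)
    (hpar : (c + r) % 2 = 0) (h1 : c + 1 ∉ A) (hV : c + 1 ∉ V)
    (hle : c + 2 + r ≤ 2 * (x + n)) :
    tilingGF q (rowRegion x n r A c V) =
      (if c + 2 ∈ A then 0 else tilingGF q (rowRegion x n r A (c + 2) V)) +
      if r + 1 < 2 * n then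
        colWeight q (c + 1) * tilingGF q (rowRegion x n r A (c + 1) (insert (c + 1) V)) else 0 := by
  have ht : (c + 1, r) ∈ rowRegion x n r A c V := by
    rw [mem_rowRegion]
    exact ⟨by omega, Or.inl ⟨rfl, by omega, h1⟩⟩
  rw [tilingGF_expand q ht ((if c + 2 ∈ A then ∅ else {((c + 1, r), (c + 2, r))}) ∪
    (if r + 1 < 2 * n then {((c + 1, r), (c + 1, r + 1))} else ∅))]
  · rw [Finset.sum_union]
    · congr 1
      · split_ifs
        · simp
        · rw [Finset.sum_singleton, symWeight_row, one_mul]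
          dsimp only
          rw [rowRegion_sdiff_row hr (Or.inl ⟨rfl, rfl⟩)]
      · split_ifs
        · rw [Finset.sum_singleton, symWeight_vertical]
          dsimp only
          rw [rowRegion_sdiff_vertical]
        · simp
    · split_ifs <;> simp
  · rintro ⟨⟨a, b⟩, ⟨a', b'⟩⟩
    simp only [isLozenge_iff, Finset.mem_union, Prod.mk.injEq, mem_rowRegion, IsUp,
      Int.even_iff]
    constructor
    · rintro (h | h)
      · split_ifs at h with h2
        · simp at h
        · simp only [Finset.mem_singleton, Prod.mk.injEq] at h
          obtain ⟨⟨rfl, rfl⟩, rfl, rfl⟩ := h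
          simp only [h1, h2, not_false_eq_true, and_true, true_and, true_or]
          omega
      · split_ifs at h with h2
        · simp only [Finset.mem_singleton, Prod.mk.injEq] at h
          obtain ⟨⟨rfl, rfl⟩, rfl, rfl⟩ := h
          simp only [h1, hV, not_false_eq_true, and_true, true_and, and_false, or_true, true_or]
          omega
        · simp at h
    · rintro ⟨h3, h4, h5, h6⟩
      have h7 : a = c + 1 ∧ b = r := by omega
      obtain ⟨rfl, rfl⟩ := h7
      rcases h3.2 with h | h | h
      · omega
      · left
        have h8 : a' = c + 2 := by omega
        obtain rfl := h8
        have : c + 2 ∉ A := by rcases h5.2 with h | h; exacts [h.2.2, by omega]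
        simp [this, h.2]
      · right
        obtain ⟨rfl, rfl⟩ := h
        have : b + 1 < 2 * n := by omega
        simp [this]

/-- If the triangle at the start of row `r` is up-pointing, then all the lozenges of row `r` up to
the next removed triangle are forced. -/
theorem tilingGF_rowRegion_forced (hr : 0 ≤ r) (hrn : r < 2 * n) (L : ℕ) (hc : 0 ≤ c)
    (hpar : (c + 1 + r) % 2 = 0) (hA : ∀ a ∈ A, c < a → c + 2 * L + 1 ≤ a)
    (hb : c + 2 * L + 1 ∈ A) (hle : c + 2 * L + 1 + r ≤ 2 * (x + n)) :
    tilingGF q (rowRegion x n r A c V) = tilingGF q (rowRegion x n r A (c + 2 * L + 1) V) := by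
  induction L generalizing c with
  | zero =>
    simp only [Nat.cast_zero, mul_zero, add_zero] at hb ⊢
    rw [rowRegion_of_mem hb]
  | succ L ih =>
    push_cast at *
    have e : c + 2 * ((L : ℤ) + 1) + 1 = c + 2 + 2 * L + 1 := by ring
    rw [e] at hb hle ⊢
    rw [tilingGF_rowRegion_up q hr hrn hc hpar (fun h => by have := hA _ h (by omega); omega)
      (fun h => by have := hA _ h (by omega); omega) (by omega)]
    exact ih (by omega) (by omega) (fun a ha h => e ▸ hA a ha (by omega)) hb hle

/-- The rest of the row starts and ends with an up-pointing triangle, so it has one up-pointing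
triangle too many. This rules out vertical lozenges after the last removed triangle. -/
theorem tilingGF_rowRegion_eq_zero (hr : 0 ≤ r) (hrn : r < 2 * n) (L : ℕ) (hc : 0 ≤ c)
    (hA : ∀ a ∈ A, a ≤ c) (hle : c + 2 * L + 1 + r = 2 * (x + n)) :
    tilingGF q (rowRegion x n r A c V) = 0 := by
  have h1 : ∀ k : ℤ, 0 < k → c + k ∉ A := fun k hk h => by have := hA _ h; omega
  induction L generalizing c with
  | zero =>
    exact tilingGF_rowRegion_up_last q hr hrn hc (by push_cast at hle; omega) (h1 1 one_pos)
      (by push_cast at hle; omega)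
  | succ L ih =>
    push_cast at *
    rw [tilingGF_rowRegion_up q hr hrn hc (by omega) (h1 1 one_pos) (h1 2 two_pos) (by omega)]
    exact ih (by omega) (fun a ha => by have := hA a ha; omega) (by omega)
      (fun k hk h => by have := hA _ h; omega)

/-- After the last removed triangle, all the lozenges of row `r` are forced. -/
theorem tilingGF_rowRegion_end (hr : 0 ≤ r) (hrn : r < 2 * n) (L : ℕ) (hc : 0 ≤ c)
    (hA : ∀ a ∈ A, a ≤ c) (hV : ∀ a ∈ V, a ≤ c) (hle : c + 2 * L + r = 2 * (x + n)) :
    tilingGF q (rowRegion x n r A c V) = tilingGF q (rowRegion x n r A (c + 2 * L) V) := by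
  have h1 : ∀ k : ℤ, 0 < k → c + k ∉ A := fun k hk h => by have := hA _ h; omega
  induction L generalizing c with
  | zero => simp
  | succ L ih =>
    push_cast at *
    have e : c + 2 * ((L : ℤ) + 1) = c + 2 + 2 * L := by ring
    rw [e] at *
    rw [tilingGF_rowRegion_down q hr hrn hc (by omega) (h1 1 one_pos)
      (fun h => by have := hV _ h; omega) (by omega), if_neg (h1 2 two_pos),
      tilingGF_rowRegion_eq_zero q hr hrn L (c := c + 1) (by omega)
        (fun a ha => by have := hA a ha; omega) (by omega)]
    rw [ih (by omega) (fun a ha => by have := hA a ha; omega)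
      (fun a ha => by have := hV a ha; omega) (by omega)
      (fun k hk h => by have := hA _ h; omega)]
    simp

/-- Between two consecutive removed triangles of row `r`, exactly one down-pointing triangle is
covered by a vertical lozenge. -/
theorem tilingGF_rowRegion_between (hr : 0 ≤ r) (hrn : r + 1 < 2 * n) (L : ℕ) (hc : 0 ≤ c)
    (hpar : (c + r) % 2 = 0) (hA : ∀ a ∈ A, c < a → c + 2 * (L + 1) ≤ a)
    (hb : c + 2 * (L + 1) ∈ A) (hV : ∀ a ∈ V, a ≤ c) (hle : c + 2 * (L + 1) + r ≤ 2 * (x + n)) :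
    tilingGF q (rowRegion x n r A c V) = ∑ l ∈ Finset.range (L + 1),
      colWeight q (c + 2 * l + 1) *
        tilingGF q (rowRegion x n r A (c + 2 * (L + 1)) (insert (c + 2 * l + 1) V)) := by
  induction L generalizing c with
  | zero =>
    simp only [Nat.cast_zero, mul_zero, add_zero, zero_add, mul_one, Finset.range_one,
      Finset.sum_singleton] at *
    rw [tilingGF_rowRegion_down q hr (by omega) hc (by omega)
      (fun h => by have := hA _ h (by omega); omega)
      (fun h => by have := hV _ h; omega) (by omega), if_pos hb, if_pos hrn, zero_add,
      rowRegion_of_mem (c := c + 1) (by rw [add_assoc]; exact hb)]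
    rw [add_assoc c 1 1, one_add_one_eq_two]
  | succ L ih =>
    push_cast at *
    have e : c + 2 * ((L : ℤ) + 1 + 1) = c + 2 + 2 * (L + 1) := by ring
    rw [tilingGF_rowRegion_down q hr (by omega) hc (by omega)
      (fun h => by have := hA _ h (by omega); omega)
      (fun h => by have := hV _ h; omega) (by omega),
      if_neg (fun h => by have := hA _ h (by omega); omega), if_pos hrn, Finset.sum_range_succ']
    rw [e] at hb hle ⊢
    congr 1
    · rw [ih (by omega) (by omega) (fun a ha h => e ▸ hA a ha (by omega)) hb
        (fun a ha => by have := hV a ha; omega) hle]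
      refine Finset.sum_congr rfl fun l _ => ?_
      have e' : c + 2 * (((l + 1 : ℕ)) : ℤ) + 1 = c + 2 + 2 * l + 1 := by push_cast; ring
      rw [e']
    -- A vertical lozenge at `c + 1` leaves an up-pointing triangle in front, so the row is forced
    -- up to the next removed triangle.
    · have e' : c + 2 + 2 * ((L : ℤ) + 1) = c + 1 + 2 * ((L + 1 : ℕ) : ℤ) + 1 := by
        push_cast; ring
      rw [e'] at hb hle ⊢
      rw [tilingGF_rowRegion_forced q hr (by omega) (L + 1) (c := c + 1) (by omega) (by omega)
        (fun a ha h => by have := hA a ha (by omega); push_cast; omega) hb hle]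
      simp

end Peeling

/-! ### Interlacing sums over the vertical lozenges of a row. -/

/-- The columns `a + 1, a + 3, …, b - 1`. -/
noncomputable def colsBetween (a b : ℤ) : Finset ℤ :=
  (Finset.range ((b - a) / 2).toNat).image fun l : ℕ => a + 2 * l + 1

theorem mem_colsBetween {a b c : ℤ} (h : (b - a) % 2 = 0) :
    c ∈ colsBetween a b ↔ a < c ∧ c < b ∧ (c - a) % 2 = 1 := by
  simp only [colsBetween, Finset.mem_image, Finset.mem_range]
  constructor
  · rintro ⟨l, hl, rfl⟩
    omega
  · intro h
    exact ⟨((c - a) / 2).toNat, by omega, by omega⟩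

theorem sum_colsBetween {K : Type*} [AddCommMonoid K] (a : ℤ) (L : ℕ) (f : ℤ → K) :
    ∑ c ∈ colsBetween a (a + 2 * L), f c = ∑ l ∈ Finset.range L, f (a + 2 * l + 1) := by
  have : ((a + 2 * (L : ℤ) - a) / 2).toNat = L := by omega
  rw [colsBetween, this, Finset.sum_image]
  intro l _ l' _ h
  simp only at h
  omega

theorem sum_piFinset_succ {K : Type*} [AddCommMonoid K] {m : ℕ} (S : Fin (m + 1) → Finset ℤ)
    (f : (Fin (m + 1) → ℤ) → K) :
    ∑ d ∈ Fintype.piFinset S, f d =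
      ∑ c ∈ S 0, ∑ d ∈ Fintype.piFinset (fun i : Fin m => S i.succ), f (Fin.cons c d) := by
  rw [Finset.sum_sigma']
  symm
  refine Finset.sum_bij' (fun p _ => Fin.cons p.1 p.2) (fun d _ => ⟨d 0, Fin.tail d⟩) ?_ ?_ ?_ ?_ ?_
  · rintro ⟨c, d⟩ h
    simpa [Fintype.mem_piFinset, Fin.forall_fin_succ] using h
  · intro d h
    simpa [Fintype.mem_piFinset, Fin.forall_fin_succ, Fin.tail] using h
  · intros; simp
  · intros; simp
  · intros; rfl

theorem rowRegion_last {x n : ℕ} {r c : ℤ} (hr : 0 ≤ r) (hc : c + r = 2 * (x + n))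
    (A V : Finset ℤ) :
    rowRegion x n r A c V = rowRegion x n (r + 1) V 0 ∅ := by
  ext ⟨a, b⟩
  simp only [mem_rowRegion, Finset.notMem_empty]
  by_cases hA : a ∈ A <;> by_cases hV : a ∈ V <;>
    simp only [hA, hV, not_true_eq_false, not_false_eq_true, and_true, and_false,
      false_or] <;> omega

/-- Induction on the number of gaps: each gap contributes one vertical lozenge, recorded in `V`,
which becomes the removed set of the next row. The start `a 0` need not lie in `A`, so it can be the
west boundary. The bound `hm` is needed only if there is a gap, so that the top row is covered by `m
= 0`. -/
theorem tilingGF_rowRegion_interlacing {K : Type*} [Field K] (q : K) {x n : ℕ} {r : ℤ}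
    (hr : 0 ≤ r) (hrn : r < 2 * n) {A : Finset ℤ} {m : ℕ} (hm : m ≠ 0 → r + 1 < 2 * n)
    (a : Fin (m + 1) → ℤ) (V : Finset ℤ)
    (ha : StrictMono a) (hpar : ∀ i, (a i + r) % 2 = 0) (h0 : 0 ≤ a 0)
    (hle : ∀ i, a i + r ≤ 2 * (x + n)) (hmem : ∀ i : Fin m, a i.succ ∈ A)
    (hA : ∀ c ∈ A, a 0 < c → ∃ i, c = a i) (hV : ∀ v ∈ V, v ≤ a 0) :
    tilingGF q (rowRegion x n r A (a 0) V) =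
      ∑ d ∈ Fintype.piFinset fun i : Fin m => colsBetween (a i.castSucc) (a i.succ),
        (∏ i, colWeight q (d i)) *
          tilingGF q (rowRegion x n (r + 1) (V ∪ Finset.univ.image d) 0 ∅) := by
  induction m generalizing V with
  | zero =>
    have h1 : a 0 + 2 * (((2 * (x + n) - r - a 0) / 2).toNat : ℤ) + r = 2 * (x + n) := by
      have := hpar 0
      have := hle 0
      omega
    rw [tilingGF_rowRegion_end q hr hrn _ h0 (fun c hc => ?_) hV h1,
      rowRegion_last hr h1]
    · simp
    · by_contra! h
      obtain ⟨i, rfl⟩ := hA c hc h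
      rw [Fin.eq_zero i] at h
      exact lt_irrefl _ h
  | succ m ih =>
    have hlt : a 0 < a 1 := ha (by simp)
    obtain ⟨L, hL⟩ : ∃ L : ℕ, a 1 = a 0 + 2 * (L + 1) := by
      refine ⟨((a 1 - a 0) / 2 - 1).toNat, ?_⟩
      have := hpar 0
      have := hpar 1
      omega
    have hmin : ∀ c ∈ A, a 0 < c → a 1 ≤ c := by
      intro c hc h
      obtain ⟨i, rfl⟩ := hA c hc h
      have : i ≠ 0 := by rintro rfl; exact lt_irrefl _ h
      exact ha.monotone (Fin.one_le_of_ne_zero this)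
    rw [tilingGF_rowRegion_between q hr (hm (by simp)) L h0 (hpar 0) (by rwa [← hL])
      (by rw [← hL]; exact hmem 0) hV (by rw [← hL]; exact hle 1), sum_piFinset_succ, ← hL]
    have hL' : a (Fin.succ 0) = a (Fin.castSucc 0) + 2 * ((L + 1 : ℕ) : ℤ) := by
      push_cast; exact hL
    rw [hL', sum_colsBetween]
    refine Finset.sum_congr rfl fun l hl => ?_
    have hl' := Finset.mem_range.mp hl
    have hI := ih (fun _ => hm (by simp)) (fun i => a i.succ) (insert (a 0 + 2 * l + 1) V)
      (ha.comp (Fin.strictMono_succ)) (fun i => hpar _) (by simpa using h0.trans hlt.le)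
      (fun i => hle _) (fun i => hmem _) ?_ ?_
    · simp only [Fin.succ_zero_eq_one] at hI
      rw [hI, Finset.mul_sum]
      refine Finset.sum_congr rfl fun d _ => ?_
      rw [Fin.prod_univ_succ]
      simp only [Fin.cons_zero, Fin.cons_succ]
      rw [mul_assoc]
      congr 4
      ext c
      simp [Fin.exists_fin_succ, or_left_comm, eq_comm]
    · intro c hc h
      simp only [Fin.succ_zero_eq_one] at h
      obtain ⟨i, rfl⟩ := hA c hc (hlt.trans h)
      obtain ⟨j, rfl⟩ := Fin.exists_succ_eq_of_ne_zero (x := i) (by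
        rintro rfl; exact lt_asymm h hlt)
      exact ⟨j, rfl⟩
    · intro v hv
      simp only [Fin.succ_zero_eq_one]
      rcases Finset.mem_insert.mp hv with rfl | hv
      · rw [hL]; omega
      · exact (hV v hv).trans hlt.le

end QuarteredHexagon

/-! ### Determinant evaluations. -/

open Matrix Polynomial in
/-- A determinant whose columns are given by a three-term recursion is a Vandermonde determinant. -/
theorem Matrix.det_of_threeTermRecursion {K : Type*} [CommRing K] {m : ℕ} (A Y : Fin m → K)
    (h : ℕ → Fin m → K) (e : K) (d : ℕ → K) (h0 : ∀ i, h 0 i = A i)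
    (h1 : ∀ i, h 1 i = A i * (Y i + e))
    (hrec : ∀ k i, h (k + 2) i = Y i * h (k + 1) i - d k * h k i) :
    (Matrix.of fun i j : Fin m => h j i).det = (∏ i, A i) * (Matrix.vandermonde Y).det := by
  nontriviality K
  -- Column `k` is `A` times a monic polynomial of degree `k` in `Y`. Two consecutive polynomials
  -- are carried along because the recursion has order two.
  have key : ∀ k : ℕ, ∃ p p' : K[X], p.Monic ∧ p.natDegree = k ∧ p'.Monic ∧
      p'.natDegree = k + 1 ∧ (∀ i, h k i = A i * p.eval (Y i)) ∧
      ∀ i, h (k + 1) i = A i * p'.eval (Y i) := by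
    intro k
    induction k with
    | zero =>
      refine ⟨1, X + C e, monic_one, natDegree_one, monic_X_add_C e, natDegree_X_add_C e, ?_, ?_⟩
      · simpa using h0
      · simpa using h1
    | succ k ih =>
      obtain ⟨p, p', hp, hpd, hp', hpd', he, he'⟩ := ih
      have hlt : (C (d k) * p).degree < (X * p').degree := by
        have hX : (X * p').degree = ((k + 2 : ℕ) : WithBot ℕ) := by
          rw [degree_eq_natDegree (monic_X.mul hp').ne_zero, natDegree_X_mul hp'.ne_zero, hpd']
        rw [hX]
        refine degree_le_natDegree.trans_lt ?_
        have := natDegree_C_mul_le (d k) p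
        exact_mod_cast (show (C (d k) * p).natDegree < k + 2 by omega)
      refine ⟨p', X * p' - C (d k) * p, hp', hpd', (monic_X.mul hp').sub_of_left hlt, ?_, he', ?_⟩
      · rw [natDegree_sub_eq_left_of_natDegree_lt, natDegree_X_mul hp'.ne_zero, hpd']
        have := natDegree_C_mul_le (d k) p
        rw [natDegree_X_mul hp'.ne_zero, hpd']
        omega
      · intro i
        rw [hrec, he, he']
        simp
        ring
  choose p p' hp hpd _ _ he _ using key
  rw [Matrix.det_eval_matrixOfPolynomials_eq_det_vandermonde Y (fun j => p j) (fun j => hpd j)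
    (fun j => hp j), ← Matrix.det_mul_column]
  congr 1
  ext i j
  simp [he]

/-- Subtracting from each row its predecessor turns the column of ones into the first unit vector.
-/
theorem Matrix.det_consecutive_differences {K : Type*} [CommRing K] {m : ℕ}
    (G : Fin (m + 1) → Fin m → K) :
    (Matrix.of fun i k : Fin m => G i.succ k - G i.castSucc k).det =
      (Matrix.of fun i : Fin (m + 1) => (Fin.cons 1 (G i) : Fin (m + 1) → K)).det := by
  symm
  rw [Matrix.det_eq_of_forall_row_eq_smul_add_pred (B := Matrix.of fun i =>
    Fin.cases (Fin.cons 1 (G 0)) (fun i => Fin.cons 0 fun k => G i.succ k - G i.castSucc k) i)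
    (fun _ => 1)]
  · rw [Matrix.det_succ_column_zero, Fin.sum_univ_succ]
    simp
    congr 1
  · intro j
    simp
  · intro i j
    refine Fin.cases ?_ (fun k => ?_) j <;> simp

namespace QuarteredHexagon

section Sums

variable {K : Type*} [Field K] (q : K)

/-- Row `i` depends on `d i` alone, so by multilinearity the sum moves into the rows, where the
antiderivative `G` makes each entry telescope. -/
theorem sum_det_colsBetween {m : ℕ} (a : Fin (m + 1) → ℤ) (ha : StrictMono a)
    (hpar : ∀ i j, (a i - a j) % 2 = 0) (g G : Fin m → ℤ → K)
    (hG : ∀ k c, G k (c + 1) - G k (c - 1) = g k c) :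
    ∑ d ∈ Fintype.piFinset fun i : Fin m => colsBetween (a i.castSucc) (a i.succ),
      (Matrix.of fun i k => g k (d i)).det =
    (Matrix.of fun i : Fin (m + 1) =>
      (Fin.cons 1 (fun k => G k (a i)) : Fin (m + 1) → K)).det := by
  rw [← Matrix.det_consecutive_differences fun i k => G k (a i)]
  have h := MultilinearMap.map_sum_finset
    (Matrix.detRowAlternating (n := Fin m) (R := K)).toMultilinearMap
    (fun (_ : Fin m) (c : ℤ) (k : Fin m) => g k c)
    (fun i : Fin m => colsBetween (a i.castSucc) (a i.succ))
  refine h.symm.trans ?_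
  change Matrix.det _ = Matrix.det _
  congr 1
  ext i k
  rw [Finset.sum_apply, Matrix.of_apply]
  obtain ⟨L, hL⟩ : ∃ L : ℕ, a i.succ = a i.castSucc + 2 * L := by
    refine ⟨((a i.succ - a i.castSucc) / 2).toNat, ?_⟩
    have := hpar i.succ i.castSucc
    have := ha (Fin.castSucc_lt_succ (i := i))
    omega
  rw [hL, sum_colsBetween]
  have : ∀ l ∈ Finset.range L, g k (a i.castSucc + 2 * l + 1) =
      G k (a i.castSucc + 2 * ((l + 1 : ℕ) : ℤ)) - G k (a i.castSucc + 2 * (l : ℤ)) := by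
    intro l _
    rw [← hG]
    push_cast
    ring_nf
  rw [Finset.sum_congr rfl this,
    Finset.sum_range_sub (fun l : ℕ => G k (a i.castSucc + 2 * (l : ℤ)))]
  simp

/-- The Vandermonde determinant in the variables `q ^ (2 c) + q ^ (-2 c)`. -/
noncomputable def colVandermonde {m : ℕ} (c : Fin m → ℤ) : K :=
  (Matrix.vandermonde fun i => q ^ (2 * c i) + q ^ (-(2 * c i))).det

/-- The difference `q ^ k - q ^ (-k)`. -/
noncomputable def qDiff (k : ℤ) : K := q ^ k - q ^ (-k)

variable {q}

theorem det_cosh_even (hq : q ≠ 0) {m : ℕ} (c : Fin (m + 1) → ℤ) :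
    (Matrix.of fun i : Fin (m + 1) => (Fin.cons 1 (fun k : Fin m =>
      q ^ (2 * ((k : ℤ) + 1) * c i) + q ^ (-(2 * ((k : ℤ) + 1) * c i))) :
        Fin (m + 1) → K)).det = colVandermonde q c := by
  have h := Matrix.det_of_threeTermRecursion (fun _ : Fin (m + 1) => (1 : K))
    (fun i => q ^ (2 * c i) + q ^ (-(2 * c i)))
    -- Column `0` is `1`, half the value `2` of the general expression; hence the coefficient `2` in
    -- the first recursion step.
    (fun k i => if k = 0 then 1 else q ^ (2 * (k : ℤ) * c i) + q ^ (-(2 * (k : ℤ) * c i)))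
    0 (fun k => if k = 0 then 2 else 1) (fun i => by simp) (fun i => by simp) ?_
  · rw [Finset.prod_const_one, one_mul] at h
    rw [colVandermonde, ← h]
    congr 1
    ext i j
    refine Fin.cases ?_ (fun k => ?_) j <;> simp
  · intro k i
    rcases k with _ | k
    · have : q ^ c i ≠ 0 := zpow_ne_zero _ hq
      have e : ∀ z : ℤ, q ^ (z * c i) = (q ^ c i) ^ z := fun z => by rw [mul_comm, zpow_mul]
      simp only [zpow_neg, e]
      generalize q ^ c i = z at *
      norm_num
      norm_cast
      field_simp
      ring
    · have : q ^ c i ≠ 0 := zpow_ne_zero _ hq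
      have e : ∀ z : ℤ, q ^ (z * c i) = (q ^ c i) ^ z := fun z => by rw [mul_comm, zpow_mul]
      simp only [zpow_neg, e, Nat.add_eq_zero_iff, one_ne_zero, and_false, if_false, OfNat.ofNat_ne_zero]
      generalize q ^ c i = z at *
      push_cast
      have e2 : ∀ j : ℤ, z ^ (2 * j) = (z ^ 2) ^ j := fun j => by rw [zpow_mul]; norm_cast
      simp only [e2, zpow_add₀ (pow_ne_zero 2 this), zpow_natCast]
      norm_num
      field_simp
      norm_cast
      field_simp
      ring

theorem det_sinh_even (hq : q ≠ 0) {m : ℕ} (c : Fin m → ℤ) :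
    (Matrix.of fun i k : Fin m => q ^ (2 * ((k : ℤ) + 1) * c i) -
      q ^ (-(2 * ((k : ℤ) + 1) * c i))).det =
      (∏ i, qDiff q (2 * c i)) * colVandermonde q c := by
  refine Matrix.det_of_threeTermRecursion _ _
    (fun k i => q ^ (2 * ((k : ℤ) + 1) * c i) - q ^ (-(2 * ((k : ℤ) + 1) * c i))) 0 (fun _ => 1)
    (fun i => by simp [qDiff]) ?_ ?_
  · intro i
    have : q ^ c i ≠ 0 := zpow_ne_zero _ hq
    have e : ∀ z : ℤ, q ^ (z * c i) = (q ^ c i) ^ z := fun z => by rw [mul_comm, zpow_mul]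
    simp only [zpow_neg, e, qDiff]
    generalize q ^ c i = z at *
    norm_num
    field_simp
    ring
  · intro k i
    have : q ^ c i ≠ 0 := zpow_ne_zero _ hq
    have e : ∀ z : ℤ, q ^ (z * c i) = (q ^ c i) ^ z := fun z => by rw [mul_comm, zpow_mul]
    simp only [zpow_neg, e]
    generalize q ^ c i = z at *
    push_cast
    have e2 : ∀ j : ℤ, z ^ (2 * j) = (z ^ 2) ^ j := fun j => by rw [zpow_mul]; norm_cast
    simp only [e2, zpow_add₀ (pow_ne_zero 2 this), zpow_natCast]
    norm_num
    field_simp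
    ring

theorem det_cosh_odd (hq : q ≠ 0) {m : ℕ} (c : Fin m → ℤ) :
    (Matrix.of fun i k : Fin m => q ^ ((2 * (k : ℤ) + 1) * c i) +
      q ^ (-((2 * (k : ℤ) + 1) * c i))).det =
      (∏ i, (q ^ c i + q ^ (-c i))) * colVandermonde q c := by
  refine Matrix.det_of_threeTermRecursion _ _
    (fun k i => q ^ ((2 * (k : ℤ) + 1) * c i) + q ^ (-((2 * (k : ℤ) + 1) * c i))) (-1)
    (fun _ => 1) (fun i => by simp) ?_ ?_
  · intro i
    have : q ^ c i ≠ 0 := zpow_ne_zero _ hq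
    have e : ∀ z : ℤ, q ^ (z * c i) = (q ^ c i) ^ z := fun z => by rw [mul_comm, zpow_mul]
    simp only [zpow_neg, e]
    generalize q ^ c i = z at *
    norm_num
    field_simp
    ring
  · intro k i
    have : q ^ c i ≠ 0 := zpow_ne_zero _ hq
    have e : ∀ z : ℤ, q ^ (z * c i) = (q ^ c i) ^ z := fun z => by rw [mul_comm, zpow_mul]
    simp only [zpow_neg, e]
    generalize q ^ c i = z at *
    push_cast
    simp only [zpow_add₀ this, mul_add, mul_one]
    have e2 : ∀ j : ℤ, z ^ (2 * j) = (z ^ 2) ^ j := fun j => by rw [zpow_mul]; norm_cast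
    simp only [e2, zpow_natCast]
    norm_num
    field_simp
    ring

theorem det_sinh_odd (hq : q ≠ 0) {m : ℕ} (c : Fin m → ℤ) :
    (Matrix.of fun i k : Fin m => q ^ ((2 * (k : ℤ) + 1) * c i) -
      q ^ (-((2 * (k : ℤ) + 1) * c i))).det =
      (∏ i, qDiff q (c i)) * colVandermonde q c := by
  refine Matrix.det_of_threeTermRecursion _ _
    (fun k i => q ^ ((2 * (k : ℤ) + 1) * c i) - q ^ (-((2 * (k : ℤ) + 1) * c i))) 1
    (fun _ => 1) (fun i => by simp [qDiff]) ?_ ?_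
  · intro i
    have : q ^ c i ≠ 0 := zpow_ne_zero _ hq
    have e : ∀ z : ℤ, q ^ (z * c i) = (q ^ c i) ^ z := fun z => by rw [mul_comm, zpow_mul]
    simp only [zpow_neg, e, qDiff]
    generalize q ^ c i = z at *
    norm_num
    norm_cast
    field_simp
    ring
  · intro k i
    have : q ^ c i ≠ 0 := zpow_ne_zero _ hq
    have e : ∀ z : ℤ, q ^ (z * c i) = (q ^ c i) ^ z := fun z => by rw [mul_comm, zpow_mul]
    simp only [zpow_neg, e]
    generalize q ^ c i = z at *
    push_cast
    simp only [zpow_add₀ this, mul_add, mul_one]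
    have e2 : ∀ j : ℤ, z ^ (2 * j) = (z ^ 2) ^ j := fun j => by rw [zpow_mul]; norm_cast
    simp only [e2, zpow_natCast]
    norm_num
    field_simp
    ring

end Sums

end QuarteredHexagon

/-! ### The product formula propagated through two rows. -/

namespace QuarteredHexagon

section Transfer

variable {K : Type*} [Field K] {q : K}

/-- The duplication formula for `sinh`; it makes the weight fit the determinant `det_sinh_even`. -/
theorem colWeight_mul_qDiff (hq : q ≠ 0) (c : ℤ) :
    colWeight q c * qDiff q c = 2⁻¹ * qDiff q (2 * c) := by
  have e : ∀ z : ℤ, q ^ (z * c) = (q ^ c) ^ z := fun z => by rw [mul_comm, zpow_mul]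
  have : q ^ c ≠ 0 := zpow_ne_zero _ hq
  simp only [colWeight, qDiff, zpow_neg, e]
  norm_cast
  field_simp
  ring

theorem cosh_sub_cosh (hq : q ≠ 0) (k c : ℤ) :
    (q ^ (k * (c + 1)) + q ^ (-(k * (c + 1)))) - (q ^ (k * (c - 1)) + q ^ (-(k * (c - 1)))) =
      qDiff q k * (q ^ (k * c) - q ^ (-(k * c))) := by
  have h1 : q ^ k ≠ 0 := zpow_ne_zero _ hq
  have h2 : q ^ (k * c) ≠ 0 := zpow_ne_zero _ hq
  simp only [qDiff, zpow_neg, mul_add, mul_sub, mul_one, zpow_add₀ hq, zpow_sub₀ hq]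
  field_simp
  ring

theorem sinh_sub_sinh (hq : q ≠ 0) (k c : ℤ) :
    (q ^ (k * (c + 1)) - q ^ (-(k * (c + 1)))) - (q ^ (k * (c - 1)) - q ^ (-(k * (c - 1)))) =
      qDiff q k * (q ^ (k * c) + q ^ (-(k * c))) := by
  have h1 : q ^ k ≠ 0 := zpow_ne_zero _ hq
  have h2 : q ^ (k * c) ≠ 0 := zpow_ne_zero _ hq
  simp only [qDiff, zpow_neg, mul_add, mul_sub, mul_one, zpow_add₀ hq, zpow_sub₀ hq]
  field_simp
  ring

theorem sum_interlacing_odd (hq : q ≠ 0) (hd : ∀ k : ℤ, 0 < k → qDiff q k ≠ 0) {m : ℕ}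
    (a : Fin (m + 1) → ℤ) (ha : StrictMono a) (hpar : ∀ i j, (a i - a j) % 2 = 0) :
    ∑ d ∈ Fintype.piFinset fun i : Fin m => colsBetween (a i.castSucc) (a i.succ),
      (∏ i, colWeight q (d i)) * ((∏ i, qDiff q (d i)) * colVandermonde q d) =
    (∏ k : Fin m, (2 * qDiff q (2 * ((k : ℤ) + 1)))⁻¹) * colVandermonde q a := by
  rw [← det_cosh_even hq, ← sum_det_colsBetween a ha hpar
    (fun k c => qDiff q (2 * ((k : ℤ) + 1)) *
      (q ^ (2 * ((k : ℤ) + 1) * c) - q ^ (-(2 * ((k : ℤ) + 1) * c))))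
    (fun k c => q ^ (2 * ((k : ℤ) + 1) * c) + q ^ (-(2 * ((k : ℤ) + 1) * c)))
    (fun k c => cosh_sub_cosh hq _ _), Finset.mul_sum]
  refine Finset.sum_congr rfl fun d _ => ?_
  have h := Matrix.det_mul_row (fun k : Fin m => qDiff q (2 * ((k : ℤ) + 1)))
    (Matrix.of fun i k : Fin m => q ^ (2 * ((k : ℤ) + 1) * d i) -
      q ^ (-(2 * ((k : ℤ) + 1) * d i)))
  simp only [Matrix.of_apply] at h
  rw [h, det_sinh_even hq, ← mul_assoc, ← mul_assoc, ← mul_assoc, ← Finset.prod_mul_distrib,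
    ← Finset.prod_mul_distrib, ← Finset.prod_mul_distrib]
  congr 1
  refine Finset.prod_congr rfl fun i _ => ?_
  rw [colWeight_mul_qDiff hq, mul_inv, inv_mul_cancel_right₀ (hd _ (by positivity))]

theorem sum_interlacing_even (hq : q ≠ 0) (hd : ∀ k : ℤ, 0 < k → qDiff q k ≠ 0) {m : ℕ}
    (a : Fin (m + 1) → ℤ) (ha : StrictMono a) (hpar : ∀ i j, (a i - a j) % 2 = 0)
    (ha0 : a 0 = 0) :
    ∑ d ∈ Fintype.piFinset fun i : Fin m => colsBetween (a i.castSucc) (a i.succ),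
      (∏ i, colWeight q (d i)) * colVandermonde q d =
    (∏ k : Fin m, (2 * qDiff q (2 * (k : ℤ) + 1))⁻¹) *
      ((∏ i : Fin m, qDiff q (a i.succ)) * colVandermonde q fun i => a i.succ) := by
  rw [← det_sinh_odd hq]
  have hS := sum_det_colsBetween a ha hpar
    (fun k c => qDiff q (2 * (k : ℤ) + 1) *
      (q ^ ((2 * (k : ℤ) + 1) * c) + q ^ (-((2 * (k : ℤ) + 1) * c))))
    (fun k c => q ^ ((2 * (k : ℤ) + 1) * c) - q ^ (-((2 * (k : ℤ) + 1) * c)))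
    (fun k c => sinh_sub_sinh hq _ _)
  -- As `a 0 = 0`, all `sinh` entries of the first row vanish and only the bordering `1` survives.
  rw [Matrix.det_succ_row_zero, Fin.sum_univ_succ] at hS
  simp only [Matrix.of_apply, ha0, mul_zero, neg_zero, sub_self, Fin.cons_zero, Fin.cons_succ,
    zero_mul, Finset.sum_const_zero, add_zero, Fin.val_zero, pow_zero, one_mul] at hS
  have hdet : ((Matrix.of fun i : Fin (m + 1) => (Fin.cons 1 (fun k : Fin m =>
      q ^ ((2 * (k : ℤ) + 1) * a i) - q ^ (-((2 * (k : ℤ) + 1) * a i))) :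
        Fin (m + 1) → K)).submatrix Fin.succ (Fin.succAbove 0)) =
      Matrix.of fun i k : Fin m => q ^ ((2 * (k : ℤ) + 1) * a i.succ) -
        q ^ (-((2 * (k : ℤ) + 1) * a i.succ)) := by
    ext i j
    simp
  rw [hdet] at hS
  rw [← hS, Finset.mul_sum]
  refine Finset.sum_congr rfl fun d _ => ?_
  have h := Matrix.det_mul_row (fun k : Fin m => qDiff q (2 * (k : ℤ) + 1))
    (Matrix.of fun i k : Fin m => q ^ ((2 * (k : ℤ) + 1) * d i) +
      q ^ (-((2 * (k : ℤ) + 1) * d i)))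
  simp only [Matrix.of_apply] at h
  rw [h, det_cosh_odd hq, ← mul_assoc, ← mul_assoc, ← Finset.prod_mul_distrib,
    ← Finset.prod_mul_distrib]
  congr 1
  refine Finset.prod_congr rfl fun i _ => ?_
  rw [mul_inv, inv_mul_cancel_right₀ (hd _ (by positivity)), colWeight, div_eq_inv_mul]

variable (q) in
-- An even row begins with a down-pointing triangle at column `1`, so the boundary plays the part of
-- a removed triangle at column `0`.
theorem tilingGF_row_even {x n : ℕ} {r : ℤ} (hr : 0 ≤ r) (hr2 : r % 2 = 0) (hrn : r < 2 * n)
    {m : ℕ} (a : Fin (m + 1) → ℤ) (ha : StrictMono a) (ha0 : a 0 = 0) (hpar : ∀ i, a i % 2 = 0)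
    (hle : ∀ i, a i + r ≤ 2 * (x + n)) :
    tilingGF q (rowRegion x n r (Finset.univ.image fun i : Fin m => a i.succ) 0 ∅) =
      ∑ d ∈ Fintype.piFinset fun i : Fin m => colsBetween (a i.castSucc) (a i.succ),
        (∏ i, colWeight q (d i)) *
          tilingGF q (rowRegion x n (r + 1) (Finset.univ.image d) 0 ∅) := by
  have h := tilingGF_rowRegion_interlacing q (x := x) hr hrn
    (A := Finset.univ.image fun i : Fin m => a i.succ) (fun _ => by omega) a ∅ ha
    (fun i => by have := hpar i; omega) ha0.ge hle (by simp) ?_ (by simp)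
  · simpa [ha0] using h
  · intro c hc _
    obtain ⟨i, -, rfl⟩ := Finset.mem_image.mp hc
    exact ⟨_, rfl⟩

variable (q) in
-- An odd row begins with an up-pointing triangle and is forced up to its first removed triangle.
theorem tilingGF_row_odd {x n : ℕ} {r : ℤ} (hr : 0 ≤ r) (hr2 : r % 2 = 1) (hrn : r < 2 * n)
    {m : ℕ} (hm : m ≠ 0 → r + 1 < 2 * n) (a : Fin (m + 1) → ℤ) (ha : StrictMono a)
    (ha0 : 0 < a 0) (hpar : ∀ i, a i % 2 = 1) (hle : ∀ i, a i + r ≤ 2 * (x + n)) :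
    tilingGF q (rowRegion x n r (Finset.univ.image a) 0 ∅) =
      ∑ d ∈ Fintype.piFinset fun i : Fin m => colsBetween (a i.castSucc) (a i.succ),
        (∏ i, colWeight q (d i)) *
          tilingGF q (rowRegion x n (r + 1) (Finset.univ.image d) 0 ∅) := by
  have h := tilingGF_rowRegion_interlacing q (x := x) hr hrn
    (A := Finset.univ.image a) hm a ∅ ha
    (fun i => by have := hpar i; omega) ha0.le hle (by simp) ?_ (by simp)
  · obtain ⟨L, hL⟩ : ∃ L : ℕ, a 0 = 0 + 2 * L + 1 :=
      ⟨((a 0) / 2).toNat, by have := hpar 0; omega⟩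
    rw [tilingGF_rowRegion_forced q hr hrn L le_rfl (by omega), ← hL]
    · simpa using h
    · intro c hc _
      obtain ⟨i, -, rfl⟩ := Finset.mem_image.mp hc
      rw [← hL]
      exact ha.monotone (Fin.zero_le i)
    · rw [← hL]
      simp
    · rw [← hL]
      exact hle 0
  · intro c hc _
    obtain ⟨i, -, rfl⟩ := Finset.mem_image.mp hc
    exact ⟨_, rfl⟩

theorem interlacing_properties {m : ℕ} {a : Fin (m + 1) → ℤ} (hpar : ∀ i j, (a i - a j) % 2 = 0)
    {d : Fin m → ℤ}
    (hd : d ∈ Fintype.piFinset fun i : Fin m => colsBetween (a i.castSucc) (a i.succ)) :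
    StrictMono d ∧ ∀ i, a i.castSucc < d i ∧ d i < a i.succ ∧ (d i - a i.castSucc) % 2 = 1 := by
  rw [Fintype.mem_piFinset] at hd
  have h := fun i => (mem_colsBetween (hpar _ _)).mp (hd i)
  refine ⟨?_, h⟩
  rcases m with _ | m
  · intro i
    exact i.elim0
  · refine Fin.strictMono_iff_lt_succ.mpr fun i => ?_
    have h1 := (h i.castSucc).2.1
    have h2 := (h i.succ).1
    rw [Fin.succ_castSucc] at h1
    exact h1.trans h2

variable (q) in
/-- The constant in the product formula for the tiling generating function. -/
noncomputable def formulaConst (m : ℕ) : K :=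
  ∏ i ∈ Finset.range m, ((∏ k : Fin i, (2 * qDiff q (2 * ((k : ℤ) + 1)))⁻¹) *
    ∏ k : Fin (i + 1), (2 * qDiff q (2 * (k : ℤ) + 1))⁻¹)

/-- Each induction step peels an even row and the odd row above it. The relation `r + 2 * m = 2 * n`
says that the removed triangles run out exactly at the north side. -/
theorem tilingGF_rowRegion_eq (hq : q ≠ 0) (hd : ∀ k : ℤ, 0 < k → qDiff q k ≠ 0) {x n m : ℕ}
    (r : ℤ) (hr : 0 ≤ r) (hrm : r + 2 * m = 2 * n) (c : Fin m → ℤ) (hc : StrictMono c)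
    (hpos : ∀ i, 0 < c i) (hpar : ∀ i, c i % 2 = 0) (hle : ∀ i, c i + r ≤ 2 * (x + n)) :
    tilingGF q (rowRegion x n r (Finset.univ.image c) 0 ∅) =
      formulaConst q m * ((∏ i, qDiff q (c i)) * colVandermonde q c) := by
  induction m generalizing r with
  | zero =>
    have : rowRegion x n r (Finset.univ.image c) 0 ∅ = ∅ := by
      refine Finset.eq_empty_of_forall_notMem fun ⟨a, b⟩ h => ?_
      rw [mem_rowRegion] at h
      omega
    rw [this, tilingGF_empty]
    simp [formulaConst, colVandermonde]
  | succ m ih =>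
    push_cast at hrm
    set a : Fin (m + 2) → ℤ := Fin.cons 0 c
    have ha : StrictMono a := by
      refine Fin.strictMono_iff_lt_succ.mpr fun i => ?_
      refine Fin.cases ?_ (fun i => ?_) i
      · simpa [a] using hpos 0
      · rw [← Fin.succ_castSucc]
        simp only [a, Fin.cons_succ]
        exact hc Fin.castSucc_lt_succ
    have hap : ∀ i, a i % 2 = 0 := fun i => by
      refine Fin.cases ?_ (fun i => ?_) i
      · simp [a]
      · simpa [a] using hpar i
    have hale : ∀ i, a i + r ≤ 2 * (x + n) := fun i => by
      refine Fin.cases ?_ (fun i => ?_) i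
      · simp only [a, Fin.cons_zero]
        omega
      · simpa [a] using hle i
    have hpp : ∀ i j, (a i - a j) % 2 = 0 := fun i j => by
      have := hap i
      have := hap j
      omega
    have hs : (fun i : Fin (m + 1) => a i.succ) = c := by
      ext i
      simp [a]
    have hrow := tilingGF_row_even q (x := x) hr (by omega) (by omega) a ha rfl hap hale
    rw [hs] at hrow
    have hsum := sum_interlacing_even hq hd a ha hpp rfl
    have hprod : ∏ i : Fin (m + 1), qDiff q (a i.succ) = ∏ i, qDiff q (c i) :=
      Finset.prod_congr rfl fun i _ => by rw [congrFun hs i]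
    rw [hs, hprod] at hsum
    rw [hrow, formulaConst, Finset.prod_range_succ, ← formulaConst, mul_assoc, mul_assoc]
    rw [← hsum, Finset.mul_sum, Finset.mul_sum]
    refine Finset.sum_congr rfl fun d hdm => ?_
    obtain ⟨hdmono, hdi⟩ := interlacing_properties hpp hdm
    have hdp : ∀ i, d i % 2 = 1 := fun i => by
      have := hdi i
      have := hap i.castSucc
      omega
    have hdpp : ∀ i j, (d i - d j) % 2 = 0 := fun i j => by
      have := hdp i
      have := hdp j
      omega
    rw [tilingGF_row_odd q (x := x) (by omega) (by omega) (by omega) (by omega) d hdmono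
      (by simpa [a] using (hdi 0).1) hdp
      (fun i => by have := hdi i; have := hale i.succ; omega)]
    have hinner : ∀ u ∈ Fintype.piFinset fun i : Fin m => colsBetween (d i.castSucc) (d i.succ),
        (∏ i, colWeight q (u i)) *
          tilingGF q (rowRegion x n (r + 1 + 1) (Finset.univ.image u) 0 ∅) =
        formulaConst q m * ((∏ i, colWeight q (u i)) *
          ((∏ i, qDiff q (u i)) * colVandermonde q u)) := by
      intro u hu
      obtain ⟨humono, hui⟩ := interlacing_properties hdpp hu
      rw [ih (r + 1 + 1) (by omega) (by omega) u humono
        (fun i => by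
          have := hui i
          have := hdi i.castSucc
          have := ha.monotone (Fin.zero_le i.castSucc.castSucc)
          have : a 0 = 0 := rfl
          omega)
        (fun i => by
          have := hui i
          have := hdp i.castSucc
          omega)
        (fun i => by
          have := hui i
          have := hdi i.succ
          have := hale i.succ.succ
          omega)]
      ring
    rw [Finset.sum_congr rfl hinner, ← Finset.mul_sum, sum_interlacing_odd hq hd d hdmono hdpp]
    ring

theorem quarteredHexagon_eq_rowRegion (x n : ℕ) (s : Fin n → ℕ) :
    quarteredHexagon x n s =
      rowRegion x n 0 (Finset.univ.image fun i => 2 * (s i : ℤ)) 0 ∅ := by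
  ext ⟨a, b⟩
  simp only [quarteredHexagon, Finset.mem_sdiff, mem_trapezoid, mem_rowRegion, Finset.mem_image,
    Finset.mem_univ, true_and, Prod.mk.injEq, Finset.notMem_empty, and_false, not_false_eq_true,
    and_true]
  by_cases h : b = 0
  · subst h
    simp only [and_true, true_and, lt_irrefl, or_false]
    constructor
    · rintro ⟨h1, h2⟩
      exact ⟨h1, by omega, h2⟩
    · rintro ⟨h1, -, h2⟩
      exact ⟨h1, h2⟩
  · have : ¬ ∃ i, 2 * (s i : ℤ) = a ∧ 0 = b := by
      rintro ⟨i, -, h'⟩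
      exact h h'.symm
    simp only [this, not_false_eq_true, and_true, h, false_and, false_or]
    omega

theorem tilingGF_quarteredHexagon (hq : q ≠ 0) (hd : ∀ k : ℤ, 0 < k → qDiff q k ≠ 0) (x n : ℕ)
    (s : Fin n → ℕ) (hs : StrictMono s) (hpos : ∀ i, 1 ≤ s i) (hle : ∀ i, s i ≤ n + x) :
    tilingGF q (quarteredHexagon x n s) = formulaConst q n *
      ((∏ i, qDiff q (2 * (s i : ℤ))) * colVandermonde q fun i => 2 * (s i : ℤ)) := by
  rw [quarteredHexagon_eq_rowRegion]
  refine tilingGF_rowRegion_eq hq hd 0 le_rfl (by simp) _ ?_ ?_ ?_ ?_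
  · intro i j h
    have := hs h
    simp only
    omega
  · intro i
    have := hpos i
    omega
  · intro i
    omega
  · intro i
    have := hle i
    omega

end Transfer

end QuarteredHexagon

/-! ### Rewriting in `q²`-integers. -/

namespace QuarteredHexagon

section Formulas

variable {K : Type*} [Field K] {q : K}

/-- The factors with even argument and those with odd argument interleave to a full factorial-like
product, matching the `q`-factorials of odd order. -/
theorem formulaConst_eq (n : ℕ) :
    formulaConst q n =
      ∏ i : Fin n, ∏ k ∈ Finset.range (2 * (i : ℕ) + 1), (2 * qDiff q ((k : ℤ) + 1))⁻¹ := by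
  rw [formulaConst, Finset.prod_range]
  refine Finset.prod_congr rfl fun i _ => ?_
  generalize (i : ℕ) = j
  induction j with
  | zero => simp
  | succ j ih =>
    rw [show 2 * (j + 1) + 1 = 2 * j + 1 + 1 + 1 by ring, Finset.prod_range_succ,
      Finset.prod_range_succ, ← ih, Fin.prod_univ_castSucc,
      Fin.prod_univ_castSucc (n := j + 1)]
    simp only [Fin.val_castSucc, Fin.val_last]
    push_cast
    rw [show 2 * (j : ℤ) + 1 + 1 = 2 * (j + 1) by ring, mul_mul_mul_comm, ← mul_assoc,
      show 2 * (j : ℤ) + 2 = 2 * (j + 1) by ring]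

theorem qInt_sq (hq : q ≠ 0) (hd : qDiff q 1 ≠ 0) (m : ℕ) :
    qInt (q ^ 2) m = q ^ ((m : ℤ) - 1) * qDiff q m * (qDiff q 1)⁻¹ := by
  have h : qInt (q ^ 2) m * (q ^ 2 - 1) = (q ^ 2) ^ m - 1 := geom_sum_mul _ _
  have h1 : q ^ 2 - 1 = q * qDiff q 1 := by
    simp only [qDiff, zpow_neg, zpow_one]
    field_simp
  rw [eq_mul_inv_iff_mul_eq₀ hd]
  apply mul_left_cancel₀ hq
  have hm : q ^ m ≠ 0 := pow_ne_zero _ hq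
  have h2 : q * (q ^ ((m : ℤ) - 1) * qDiff q m) = (q ^ 2) ^ m - 1 := by
    simp only [qDiff, zpow_neg, zpow_sub₀ hq, zpow_natCast, zpow_one]
    field_simp
    ring
  rw [h2, ← h, h1]
  ring

/-- The identity for `sinh(a + b) sinh(a - b)` yields a difference of Vandermonde nodes. The
prefactor depends only on the larger index `t`. -/
theorem qInt_mul_qInt (hq : q ≠ 0) (hd : qDiff q 1 ≠ 0) {s t : ℕ} (h : s ≤ t) :
    qInt (q ^ 2) (2 * (s + t)) * qInt (q ^ 2) (2 * (t - s)) =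
      q ^ (4 * (t : ℤ) - 2) * (qDiff q 1)⁻¹ ^ 2 *
        ((q ^ (2 * (2 * (t : ℤ))) + q ^ (-(2 * (2 * (t : ℤ))))) -
          (q ^ (2 * (2 * (s : ℤ))) + q ^ (-(2 * (2 * (s : ℤ)))))) := by
  rw [qInt_sq hq hd, qInt_sq hq hd]
  obtain ⟨u, rfl⟩ := Nat.exists_eq_add_of_le h
  have h1 : q ^ s ≠ 0 := pow_ne_zero _ hq
  have h2 : q ^ u ≠ 0 := pow_ne_zero _ hq
  simp only [add_tsub_cancel_left]
  have e : ∀ a b : ℤ, q ^ (a * s + b * u) = (q ^ s) ^ a * (q ^ u) ^ b := fun a b => by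
    rw [zpow_add₀ hq, mul_comm a, mul_comm b, zpow_mul, zpow_mul, zpow_natCast, zpow_natCast]
  have e1 : q ^ (((2 * (s + (s + u)) : ℕ) : ℤ) - 1) * q ^ (((2 * u : ℕ) : ℤ) - 1) =
      q ^ (4 * ((s + u : ℕ) : ℤ) - 2) := by
    rw [← zpow_add₀ hq]
    congr 1
    push_cast
    ring
  have e2 : qDiff q ((2 * (s + (s + u)) : ℕ) : ℤ) * qDiff q ((2 * u : ℕ) : ℤ) =
      (q ^ (2 * (2 * ((s + u : ℕ) : ℤ))) + q ^ (-(2 * (2 * ((s + u : ℕ) : ℤ))))) -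
          (q ^ (2 * (2 * (s : ℤ))) + q ^ (-(2 * (2 * (s : ℤ))))) := by
    have p1 : (((2 * (s + (s + u)) : ℕ) : ℤ)) = 4 * s + 2 * u := by push_cast; ring
    have p2 : (((2 * u : ℕ) : ℤ)) = 0 * s + 2 * u := by push_cast; ring
    have p3 : 2 * (2 * ((s + u : ℕ) : ℤ)) = 4 * s + 4 * u := by push_cast; ring
    have p4 : 2 * (2 * (s : ℤ)) = 4 * s + 0 * u := by ring
    rw [p1, p2, p3, p4]
    simp only [qDiff, zpow_neg, e]
    norm_cast
    field_simp
    ring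
  rw [← e1, ← e2]
  ring

theorem qFactorial_sq (hq : q ≠ 0) (hd : qDiff q 1 ≠ 0) (j : ℕ) :
    qFactorial (q ^ 2) (2 * j + 1) = q ^ (j * (2 * j + 1)) * (qDiff q 1)⁻¹ ^ (2 * j + 1) *
      ∏ k ∈ Finset.range (2 * j + 1), qDiff q ((k : ℤ) + 1) := by
  have h : ∀ k ∈ Finset.range (2 * j + 1), qInt (q ^ 2) (k + 1) =
      q ^ k * (qDiff q 1)⁻¹ * qDiff q ((k : ℤ) + 1) := by
    intro k _
    rw [qInt_sq hq hd]
    push_cast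
    rw [add_sub_cancel_right, zpow_natCast]
    ring
  rw [qFactorial, Finset.prod_congr rfl h, Finset.prod_mul_distrib, Finset.prod_mul_distrib,
    Finset.prod_pow_eq_pow_sum, Finset.prod_const, Finset.card_range, Finset.sum_range_id]
  congr 3
  rw [Nat.add_sub_cancel, mul_comm, mul_assoc, Nat.mul_div_cancel_left _ two_pos]

theorem prod_Ioi_eq_prod_Iio {M : Type*} [CommMonoid M] {n : ℕ} (f : Fin n → Fin n → M) :
    ∏ i : Fin n, ∏ j ∈ Finset.Ioi i, f i j = ∏ j : Fin n, ∏ i ∈ Finset.Iio j, f i j :=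
  Finset.prod_comm' (by simp)

theorem prod_Ici_eq_prod_Iic {M : Type*} [CommMonoid M] {n : ℕ} (f : Fin n → Fin n → M) :
    ∏ i : Fin n, ∏ j ∈ Finset.Ici i, f i j = ∏ j : Fin n, ∏ i ∈ Finset.Iic j, f i j :=
  Finset.prod_comm' (by simp)

theorem zpow_qExponent (hq : q ≠ 0) (n : ℕ) (s : Fin n → ℕ) :
    q ^ (-qExponent n s) = ∏ i : Fin n, q ^ (-((4 * ((i : ℤ) + 1) - 2) * (s i : ℤ) -
      2 * ((i : ℤ) + 1) ^ 2 + ((i : ℤ) + 1))) := by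
  rw [qExponent, ← Finset.sum_neg_distrib]
  induction (Finset.univ : Finset (Fin n)) using Finset.cons_induction with
  | empty => simp
  | cons a t ha ih => rw [Finset.sum_cons, Finset.prod_cons, zpow_add₀ hq, ih]

theorem two_pow_sq (n : ℕ) : (2 : K) ^ (n ^ 2) = ∏ i : Fin n, 2 ^ (2 * (i : ℕ) + 1) := by
  induction n with
  | zero => simp
  | succ n ih =>
    rw [Fin.prod_univ_castSucc]
    simp only [Fin.val_castSucc, Fin.val_last]
    rw [← ih, ← pow_add]
    congr 1
    ring

theorem product_formula (hq : q ≠ 0) (hd : ∀ k : ℤ, 0 < k → qDiff q k ≠ 0) (n : ℕ)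
    (s : Fin n → ℕ) (hs : StrictMono s) :
    formulaConst q n *
      ((∏ i, qDiff q (2 * (s i : ℤ))) * colVandermonde q fun i => 2 * (s i : ℤ)) =
    ((2 : K) ^ (n ^ 2))⁻¹ * q ^ (-qExponent n s) *
      (((∏ i : Fin n, qInt (q ^ 2) (2 * s i)) *
        ∏ i : Fin n, ∏ j ∈ Finset.Ioi i,
          qInt (q ^ 2) (2 * (s i + s j)) * qInt (q ^ 2) (2 * (s j - s i))) /
        ∏ i : Fin n, qFactorial (q ^ 2) (2 * (i : ℕ) + 1)) := by
  have hδ := hd 1 one_pos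
  have hpair : ∏ i : Fin n, ∏ j ∈ Finset.Ioi i,
      qInt (q ^ 2) (2 * (s i + s j)) * qInt (q ^ 2) (2 * (s j - s i)) =
      (∏ j : Fin n, (q ^ (4 * (s j : ℤ) - 2) * (qDiff q 1)⁻¹ ^ 2) ^ (j : ℕ)) *
        colVandermonde q fun i => 2 * (s i : ℤ) := by
    have h : ∀ i : Fin n, ∀ j ∈ Finset.Ioi i, qInt (q ^ 2) (2 * (s i + s j)) *
        qInt (q ^ 2) (2 * (s j - s i)) = q ^ (4 * (s j : ℤ) - 2) * (qDiff q 1)⁻¹ ^ 2 *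
        ((q ^ (2 * (2 * (s j : ℤ))) + q ^ (-(2 * (2 * (s j : ℤ))))) -
          (q ^ (2 * (2 * (s i : ℤ))) + q ^ (-(2 * (2 * (s i : ℤ)))))) := fun i j hj =>
      qInt_mul_qInt hq hδ (hs.monotone (Finset.mem_Ioi.mp hj).le)
    rw [Finset.prod_congr rfl fun i _ => Finset.prod_congr rfl (h i)]
    simp only [Finset.prod_mul_distrib (s := Finset.Ioi _)]
    rw [Finset.prod_mul_distrib, colVandermonde, Matrix.det_vandermonde]
    congr 1
    simp only [← Finset.prod_mul_distrib (s := Finset.Ioi _)]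
    -- Grouped by the larger index `j`, the prefactor occurs once for each smaller index, that is
    -- `j` times.
    rw [prod_Ioi_eq_prod_Iio]
    simp only [Finset.prod_const, Fin.card_Iio]
  rw [hpair, formulaConst_eq, zpow_qExponent hq, two_pow_sq, ← Finset.prod_inv_distrib,
    ← mul_assoc, ← mul_assoc, mul_div_right_comm, ← mul_assoc, ← Finset.prod_mul_distrib,
    ← Finset.prod_mul_distrib, ← Finset.prod_mul_distrib, ← Finset.prod_div_distrib,
    ← Finset.prod_mul_distrib]
  congr 1
  refine Finset.prod_congr rfl fun i _ => ?_
  rw [qInt_sq hq hδ, qFactorial_sq hq hδ]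
  have hF : ∏ k ∈ Finset.range (2 * (i : ℕ) + 1), qDiff q ((k : ℤ) + 1) ≠ 0 :=
    Finset.prod_ne_zero_iff.mpr fun k _ => hd _ (by positivity)
  simp only [mul_inv, Finset.prod_mul_distrib, Finset.prod_const, Finset.card_range,
    Finset.prod_inv_distrib]
  have hexp : q ^ (-((4 * ((i : ℤ) + 1) - 2) * (s i : ℤ) - 2 * ((i : ℤ) + 1) ^ 2 +
      ((i : ℤ) + 1))) * q ^ (((2 * s i : ℕ) : ℤ) - 1) * (q ^ (4 * (s i : ℤ) - 2)) ^ (i : ℕ) =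
      q ^ ((i : ℕ) * (2 * (i : ℕ) + 1)) := by
    rw [← zpow_natCast, ← zpow_natCast, ← zpow_mul, ← zpow_add₀ hq, ← zpow_add₀ hq]
    congr 1
    push_cast
    ring
  have hqi : q ^ ((i : ℕ) * (2 * (i : ℕ) + 1)) ≠ 0 := pow_ne_zero _ hq
  rw [eq_comm, mul_div_assoc', div_eq_iff (by
    refine mul_ne_zero (mul_ne_zero hqi (pow_ne_zero _ (inv_ne_zero hδ))) hF), ← hexp]
  generalize (qDiff q 1)⁻¹ = ε
  generalize ∏ k ∈ Finset.range (2 * (i : ℕ) + 1), qDiff q ((k : ℤ) + 1) = F at hF ⊢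
  generalize q ^ (-((4 * ((i : ℤ) + 1) - 2) * (s i : ℤ) - 2 * ((i : ℤ) + 1) ^ 2 +
      ((i : ℤ) + 1))) = a
  generalize q ^ (((2 * s i : ℕ) : ℤ) - 1) = b
  generalize q ^ (4 * (s i : ℤ) - 2) = c
  push_cast
  generalize qDiff q (2 * (s i : ℤ)) = e
  rw [← inv_pow]
  generalize (2 : K)⁻¹ = h
  linear_combination (-(h ^ (2 * (i : ℕ) + 1) * a * b * c ^ (i : ℕ) * e *
    ε ^ (2 * (i : ℕ) + 1))) * inv_mul_cancel₀ hF

theorem prod_Iio_val {M : Type*} [CommMonoid M] {n : ℕ} (j : Fin n) (f : ℕ → M) :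
    ∏ i ∈ Finset.Iio j, f i = ∏ i ∈ Finset.range j, f i := by
  rw [← Nat.Iio_eq_range, ← Fin.map_valEmbedding_Iio, Finset.prod_map]
  rfl

theorem prod_Iic_val {M : Type*} [CommMonoid M] {n : ℕ} (j : Fin n) (f : ℕ → M) :
    ∏ i ∈ Finset.Iic j, f i = ∏ i ∈ Finset.range (j + 1), f i := by
  rw [Nat.range_succ_eq_Iic, ← Fin.map_valEmbedding_Iic, Finset.prod_map]
  rfl

/-- For fixed `j`, the differences `j - i` run through `1, …, j` and the sums `i + j + 1` through `j
+ 1, …, 2j + 1`. -/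
theorem prod_qFactorial_odd (p : K) (n : ℕ) :
    ∏ i : Fin n, qFactorial p (2 * (i : ℕ) + 1) =
      (∏ i : Fin n, ∏ j ∈ Finset.Ici i, qInt p ((i : ℕ) + (j : ℕ) + 1)) *
        ∏ i : Fin n, ∏ j ∈ Finset.Ioi i, qInt p ((j : ℕ) - (i : ℕ)) := by
  rw [prod_Ioi_eq_prod_Iio, prod_Ici_eq_prod_Iic, ← Finset.prod_mul_distrib]
  refine Finset.prod_congr rfl fun j _ => ?_
  rw [prod_Iic_val j fun i => qInt p (i + (j : ℕ) + 1), prod_Iio_val j fun i => qInt p (j - i),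
    qFactorial, show 2 * (j : ℕ) + 1 = j + (j + 1) by ring, Finset.prod_range_add, mul_comm]
  congr 1
  · refine Finset.prod_congr rfl fun i _ => ?_
    rw [add_comm i]
  · rw [← Finset.prod_range_reflect]
    refine Finset.prod_congr rfl fun i hi => ?_
    have := Finset.mem_range.mp hi
    congr 1
    omega

theorem qInt_two_mul_add_self (p : K) (s : ℕ) :
    qInt p (2 * (s + s)) = qInt p (2 * s) * (p ^ (2 * s) + 1) := by
  rw [qInt, show 2 * (s + s) = 2 * s + 2 * s by ring, Finset.sum_range_add, mul_add, mul_one,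
    add_comm, qInt, Finset.sum_mul]
  congr 1
  exact Finset.sum_congr rfl fun k _ => by ring

/-- The factor `q ^ (4 * s i) + 1` is the quotient of the diagonal term `i = j` by `qInt (q ^ 2) (2
* s i)`. -/
theorem product_formula_symmetric (n : ℕ) (s : Fin n → ℕ)
    (h : ∀ i, q ^ (4 * s i) + 1 ≠ 0) :
    (((∏ i : Fin n, qInt (q ^ 2) (2 * s i)) *
        ∏ i : Fin n, ∏ j ∈ Finset.Ioi i,
          qInt (q ^ 2) (2 * (s i + s j)) * qInt (q ^ 2) (2 * (s j - s i))) /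
        ∏ i : Fin n, qFactorial (q ^ 2) (2 * (i : ℕ) + 1)) =
    (∏ i : Fin n, 1 / (q ^ (4 * s i) + 1)) *
      (∏ i : Fin n, ∏ j ∈ Finset.Ici i,
        qInt (q ^ 2) (2 * (s i + s j)) / qInt (q ^ 2) ((i : ℕ) + (j : ℕ) + 1)) *
      (∏ i : Fin n, ∏ j ∈ Finset.Ioi i,
        qInt (q ^ 2) (2 * (s j - s i)) / qInt (q ^ 2) ((j : ℕ) - (i : ℕ))) := by
  have hdiag : ∀ i, qInt (q ^ 2) (2 * s i) =
      1 / (q ^ (4 * s i) + 1) * qInt (q ^ 2) (2 * (s i + s i)) := fun i => by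
    rw [qInt_two_mul_add_self, ← pow_mul, show 2 * (2 * s i) = 4 * s i by ring]
    field_simp [h i]
  rw [prod_qFactorial_odd, Finset.prod_congr rfl fun i _ => hdiag i]
  simp only [Finset.prod_div_distrib, Finset.prod_mul_distrib, ← Finset.mul_prod_Ioi_eq_prod_Ici]
  ring

end Formulas

/-- The two powers have degrees `k` and `-k`. -/
theorem ratFuncX_zpow_sub_ne_zero (k : ℤ) (hk : 0 < k) : qDiff (RatFunc.X : RatFunc ℚ) k ≠ 0 := by
  intro h
  rw [qDiff, sub_eq_zero] at h
  have h1 := congrArg RatFunc.intDegree h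
  have h2 : ∀ m : ℕ, RatFunc.intDegree ((RatFunc.X : RatFunc ℚ) ^ m) = m := fun m => by
    rw [← RatFunc.algebraMap_X, ← map_pow, RatFunc.intDegree_polynomial]
    simp
  lift k to ℕ using hk.le
  rw [zpow_neg, RatFunc.intDegree_inv, zpow_natCast, h2] at h1
  omega

end QuarteredHexagon

/-- `q` is the indeterminate of the field `ℚ(q)`. The indices `1 ≤ i, j ≤ n` of the formulas are
`(i : Fin n) + 1`, `(j : Fin n) + 1`; so `2i - 1`, `i + j - 1`, `j - i` become `2 * i + 1`,
`i + j + 1`, `j - i`. All subtractions of natural numbers below are of a smaller number from a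
larger one. -/
theorem mainTheorem4 (x n : ℕ) (s : Fin n → ℕ) (hs : StrictMono s)
    (hpos : ∀ i, 1 ≤ s i) (hle : ∀ i, s i ≤ n + x)
    (q : RatFunc ℚ) (hq : q = RatFunc.X) :
    QuarteredHexagon.tilingGF q (QuarteredHexagon.quarteredHexagon x n s) =
        ((2 : RatFunc ℚ) ^ (n ^ 2))⁻¹ * q ^ (-QuarteredHexagon.qExponent n s) *
          (((∏ i : Fin n, QuarteredHexagon.qInt (q ^ 2) (2 * s i)) *
              ∏ i : Fin n, ∏ j ∈ Finset.Ioi i,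
                QuarteredHexagon.qInt (q ^ 2) (2 * (s i + s j)) *
                  QuarteredHexagon.qInt (q ^ 2) (2 * (s j - s i))) /
            ∏ i : Fin n, QuarteredHexagon.qFactorial (q ^ 2) (2 * (i : ℕ) + 1)) ∧
    QuarteredHexagon.tilingGF q (QuarteredHexagon.quarteredHexagon x n s) =
        ((2 : RatFunc ℚ) ^ (n ^ 2))⁻¹ * q ^ (-QuarteredHexagon.qExponent n s) *
          (∏ i : Fin n, 1 / (q ^ (4 * s i) + 1)) *
          (∏ i : Fin n, ∏ j ∈ Finset.Ici i,
            QuarteredHexagon.qInt (q ^ 2) (2 * (s i + s j)) /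
              QuarteredHexagon.qInt (q ^ 2) ((i : ℕ) + (j : ℕ) + 1)) *
          (∏ i : Fin n, ∏ j ∈ Finset.Ioi i,
            QuarteredHexagon.qInt (q ^ 2) (2 * (s j - s i)) /
              QuarteredHexagon.qInt (q ^ 2) ((j : ℕ) - (i : ℕ))) := by
  have hq0 : q ≠ 0 := hq ▸ RatFunc.X_ne_zero
  have hd : ∀ k : ℤ, 0 < k → QuarteredHexagon.qDiff q k ≠ 0 :=
    hq ▸ QuarteredHexagon.ratFuncX_zpow_sub_ne_zero
  have hsum : ∀ i, q ^ (4 * s i) + 1 ≠ 0 := fun i h => by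
    -- If `q ^ (4 * s i)` were `-1`, it would equal its own inverse and `qDiff` would vanish.
    refine hd (4 * (s i : ℤ)) (by have := hpos i; omega) ?_
    have h' : q ^ (4 * (s i : ℤ)) = -1 := by
      rw [← eq_neg_iff_add_eq_zero] at h
      exact_mod_cast h
    rw [QuarteredHexagon.qDiff, zpow_neg, h']
    norm_num
  rw [QuarteredHexagon.tilingGF_quarteredHexagon hq0 hd x n s hs hpos hle,
    QuarteredHexagon.product_formula hq0 hd n s hs]
  refine ⟨rfl, ?_⟩
  rw [QuarteredHexagon.product_formula_symmetric n s hsum]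
  ring
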